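/- Let $\Phi\in\mathbb R$ with $\Phi/(2\pi)$ irrational and let $\theta\in\mathbb R$. Write $C_H=\frac1{\sqrt2}\begin{pmatrix}1&1\\1&-1\end{pmatrix}$. *The magnetic walk.* On $\ell^2(\mathbb Z^2)$ let $T_1,T_2$ be the magnetic translations in the symmetric gauge, $T_1|x\rangle=e^{-ix_2\Phi/2}|x+e_1\rangle$ and $T_2|x\rangle=e^{ix_1\Phi/2}|x+e_2\rangle$, and let $$W_\Phi=\begin{pmatrix}T_1&0\\0&T_1^*\end{pmatrix}C_H\begin{pmatrix}T_2&0\\0&T_2^*\end{pmatrix}C_H \quad\text{on }\ell^2(\mathbb Z^2)\otimes\mathbb C^2 .$$ *The unitary critical almost Mathieu operator.* On $\ell^2(\mathbb Z)\otimes\mathbb C^2$, with basis $|x,s\rangle$, $x\in\mathbb Z$, $s=\pm1$, let $\widetilde W_\Phi=S\,C_2(\Phi)$, where $S|x,s\rangle=|x+s,s\rangle$ and $C_2(\Phi)$ acts on the internal degree of freedom at $x$ by $$\begin{pmatrix}\cos(\Phi x+\theta)&-\sin(\Phi x+\theta)\\ \sin(\Phi x+\theta)&\cos(\Phi x+\theta)\end{pmatrix}.$$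 *The abstract walk.* Let $\mathcal A_\Phi$ be the universal $C^*$-algebra generated by two unitaries $u,v$ with $uv=e^{-i\Phi}vu$, and let $$w=\begin{pmatrix}u&0\\0&u^*\end{pmatrix}C_H\begin{pmatrix}v&0\\0&v^*\end{pmatrix}C_H\in\mathbb M_2(\mathcal A_\Phi).$$ Let $\pi_2$ be the representation of $\mathcal A_\Phi$ on $\ell^2(\mathbb Z^2)$ with $\pi_2(u)=T_1$, $\pi_2(v)=T_2$, let $\pi_1$ be the representation on $\ell^2(\mathbb Z)$ with $\pi_1(u)|x\rangle=|x+1\rangle$, $\pi_1(v)|x\rangle=e^{i(x\Phi+\theta)}|x\rangle$, and let $\Pi_j(a)=\sum_{k,l}e_{kl}\otimes\pi_j(a_{kl})$ be the induced representations of $\mathbb M_2(\mathcal A_\Phi)$. Then $\mathcal A_\Phi$ is simple (it is nonzero and its only closed two-sided ideals are $0$ and $\mathcal A_\Phi$), $W_\Phi=\Pi_2(w)$, the operator $\widetilde W_\Phi$ is unitarily equivalent to $\Pi_1(w)$, and $W_\Phi$ and $\widetilde W_\Phi$ have the same spectrum as subsets of $\mathbb C$: $$\sigma(W_\Phi)=\sigma(\Pi_2(w))=\sigma(\Pi_1(w))=\sigma(\widetilde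 W_\Phi).$$ -/

import Mathlib

open scoped ComplexConjugate

noncomputable section

namespace MagneticWalk

/-! ### The rotation algebra -/

/-- The complex group algebra of the free group on two letters, which is the free unital complex
`*`-algebra on two unitaries. The parameter `Φ` selects the seminorm it is given below. -/
def FreeUnitaryAlgebra (_Φ : ℝ) : Type := MonoidAlgebra ℂ (FreeGroup (Fin 2))

namespace FreeUnitaryAlgebra

variable (Φ : ℝ)

instance : Ring (FreeUnitaryAlgebra Φ) :=
  inferInstanceAs (Ring (MonoidAlgebra ℂ (FreeGroup (Fin 2))))

instance : Algebra ℂ (FreeUnitaryAlgebra Φ) :=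
  inferInstanceAs (Algebra ℂ (MonoidAlgebra ℂ (FreeGroup (Fin 2))))

/-- The monomial `c • g`. -/
def mono (g : FreeGroup (Fin 2)) (c : ℂ) : FreeUnitaryAlgebra Φ := MonoidAlgebra.single g c

theorem mono_induction {P : FreeUnitaryAlgebra Φ → Prop} (a : FreeUnitaryAlgebra Φ) (h0 : P 0)
    (hadd : ∀ a b, P a → P b → P (a + b)) (hmono : ∀ g c, P (mono Φ g c)) : P a :=
  MonoidAlgebra.induction_linear (motive := P) a h0 hadd hmono

theorem mono_mul (g h : FreeGroup (Fin 2)) (c d : ℂ) :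
    mono Φ g c * mono Φ h d = mono Φ (g * h) (c * d) :=
  MonoidAlgebra.single_mul_single ..

theorem one_eq_mono : (1 : FreeUnitaryAlgebra Φ) = mono Φ 1 1 := rfl

theorem smul_mono (z : ℂ) (g : FreeGroup (Fin 2)) (c : ℂ) :
    z • mono Φ g c = mono Φ g (z * c) :=
  MonoidAlgebra.smul_single' z g c

/-- The conjugate-linear map with `g ↦ g⁻¹` for `g` in the free group. -/
def starHom : FreeUnitaryAlgebra Φ →+ FreeUnitaryAlgebra Φ :=
  MonoidAlgebra.liftNC
    ((MonoidAlgebra.singleAddHom (1 : FreeGroup (Fin 2))).comp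
      (starRingEnd ℂ : ℂ →+* ℂ).toAddMonoidHom)
    (fun g => MonoidAlgebra.single g⁻¹ (1 : ℂ))

instance : Star (FreeUnitaryAlgebra Φ) := ⟨starHom Φ⟩

theorem star_mono (g : FreeGroup (Fin 2)) (c : ℂ) :
    star (mono Φ g c) = mono Φ g⁻¹ (conj c) := by
  change starHom Φ (MonoidAlgebra.single g c) = MonoidAlgebra.single g⁻¹ (conj c)
  simp only [starHom]
  erw [MonoidAlgebra.liftNC_single]
  refine (MonoidAlgebra.single_mul_single (1 : FreeGroup (Fin 2)) g⁻¹ (conj c) (1 : ℂ)).trans ?_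
  rw [one_mul, mul_one]

theorem star_add' (a b : FreeUnitaryAlgebra Φ) : star (a + b) = star a + star b :=
  map_add (starHom Φ) a b

theorem star_zero' : star (0 : FreeUnitaryAlgebra Φ) = 0 := map_zero (starHom Φ)

instance : StarRing (FreeUnitaryAlgebra Φ) where
  star_involutive a := by
    induction a using mono_induction with
    | h0 => simp only [star_zero']
    | hadd a b ha hb => simp only [star_add', ha, hb]
    | hmono g c => simp [star_mono]
  star_add := star_add' Φ
  star_mul a b := by
    induction a using mono_induction with
    | h0 => simp [star_zero']
    | hadd a a' ha ha' => simp [star_add', add_mul, mul_add, ha, ha']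
    | hmono g c =>
      induction b using mono_induction with
      | h0 => simp [star_zero']
      | hadd b b' hb hb' => simp [star_add', add_mul, mul_add, hb, hb']
      | hmono h d => simp [star_mono, mono_mul, mul_comm]

instance : StarModule ℂ (FreeUnitaryAlgebra Φ) where
  star_smul z a := by
    induction a using mono_induction with
    | h0 => simp
    | hadd a b ha hb => simp [ha, hb]
    | hmono g c => simp [star_mono, smul_mono]

/-- The two canonical generators. -/
def gen (i : Fin 2) : FreeUnitaryAlgebra Φ := mono Φ (FreeGroup.of i) 1

/-- The C*-seminorms on the free `*`-algebra on two unitaries `u`, `v` for which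
`u v = exp (-i Φ) v u` holds up to a null vector. -/
structure IsRotationSeminorm (p : Seminorm ℂ (FreeUnitaryAlgebra Φ)) : Prop where
  mul_le : ∀ a b, p (a * b) ≤ p a * p b
  star_mul_self : ∀ a, p (star a * a) = p a * p a
  relation : p (gen Φ 0 * gen Φ 1 - Complex.exp (-(Φ * Complex.I)) • (gen Φ 1 * gen Φ 0)) = 0

variable {Φ}

theorem IsRotationSeminorm.one_le {p : Seminorm ℂ (FreeUnitaryAlgebra Φ)}
    (hp : IsRotationSeminorm Φ p) : p 1 ≤ 1 := by
  have h := hp.star_mul_self 1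
  simp only [star_one, mul_one] at h
  nlinarith [apply_nonneg p 1]

theorem IsRotationSeminorm.mono_le {p : Seminorm ℂ (FreeUnitaryAlgebra Φ)}
    (hp : IsRotationSeminorm Φ p) (g : FreeGroup (Fin 2)) (c : ℂ) : p (mono Φ g c) ≤ ‖c‖ := by
  have h := hp.star_mul_self (mono Φ g 1)
  rw [star_mono, mono_mul] at h
  simp only [inv_mul_cancel, map_one, mul_one, ← one_eq_mono] at h
  have h1 : p (mono Φ g 1) ≤ 1 := by
    nlinarith [apply_nonneg p (mono Φ g 1), hp.one_le]
  have h2 : mono Φ g c = c • mono Φ g 1 := by rw [smul_mono, mul_one]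
  rw [h2, map_smul_eq_mul]
  nlinarith [norm_nonneg c]

theorem IsRotationSeminorm.star_eq {p : Seminorm ℂ (FreeUnitaryAlgebra Φ)}
    (hp : IsRotationSeminorm Φ p) (a : FreeUnitaryAlgebra Φ) : p (star a) = p a := by
  have key : ∀ b, p b ≤ p (star b) := by
    intro b
    by_contra! hlt
    have h1 := hp.star_mul_self b
    have h2 := hp.mul_le (star b) b
    nlinarith [apply_nonneg p b, apply_nonneg p (star b)]
  exact le_antisymm (by simpa using key (star a)) (key a)

theorem bddAbove (a : FreeUnitaryAlgebra Φ) :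
    BddAbove (Set.range fun p : {p : Seminorm ℂ (FreeUnitaryAlgebra Φ) //
      IsRotationSeminorm Φ p} => p.1 a) := by
  suffices h : ∃ C, ∀ p : {p : Seminorm ℂ (FreeUnitaryAlgebra Φ) // IsRotationSeminorm Φ p},
      p.1 a ≤ C by
    obtain ⟨C, hC⟩ := h
    exact ⟨C, by rintro _ ⟨p, rfl⟩; exact hC p⟩
  induction a using mono_induction with
  | h0 => exact ⟨0, fun p => by simp⟩
  | hadd a b ha hb =>
    obtain ⟨C, hC⟩ := ha
    obtain ⟨D, hD⟩ := hb
    exact ⟨C + D, fun p => (map_add_le_add p.1 a b).trans (add_le_add (hC p) (hD p))⟩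
  | hmono g c => exact ⟨‖c‖, fun p => p.2.mono_le g c⟩

instance : Nonempty {p : Seminorm ℂ (FreeUnitaryAlgebra Φ) // IsRotationSeminorm Φ p} :=
  ⟨⟨0, by constructor <;> simp⟩⟩

/-- The largest C*-seminorm: the supremum of all of them. -/
def maxNorm (a : FreeUnitaryAlgebra Φ) : ℝ :=
  ⨆ p : {p : Seminorm ℂ (FreeUnitaryAlgebra Φ) // IsRotationSeminorm Φ p}, p.1 a

theorem le_maxNorm {p : Seminorm ℂ (FreeUnitaryAlgebra Φ)} (hp : IsRotationSeminorm Φ p)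
    (a : FreeUnitaryAlgebra Φ) : p a ≤ maxNorm a :=
  le_ciSup (bddAbove a) (⟨p, hp⟩ : {p // IsRotationSeminorm Φ p})

theorem maxNorm_nonneg (a : FreeUnitaryAlgebra Φ) : 0 ≤ maxNorm a :=
  Real.iSup_nonneg fun p => apply_nonneg p.1 a

variable (Φ) in
/-- `maxNorm` as a ring seminorm. -/
def maxRingSeminorm : RingSeminorm (FreeUnitaryAlgebra Φ) where
  toFun := maxNorm
  map_zero' := by simp [maxNorm]
  add_le' a b := ciSup_le fun p =>
    (map_add_le_add p.1 a b).trans (add_le_add (le_maxNorm p.2 a) (le_maxNorm p.2 b))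
  neg' a := by simp [maxNorm]
  mul_le' a b := ciSup_le fun p => (p.2.mul_le a b).trans
    (mul_le_mul (le_maxNorm p.2 a) (le_maxNorm p.2 b) (apply_nonneg _ _) (maxNorm_nonneg a))

instance : SeminormedRing (FreeUnitaryAlgebra Φ) :=
  { (maxRingSeminorm Φ).toSeminormedRing with
    toRing := inferInstance }

theorem norm_def (a : FreeUnitaryAlgebra Φ) : ‖a‖ = maxNorm a := rfl

instance : NormedSpace ℂ (FreeUnitaryAlgebra Φ) where
  norm_smul_le z a := ciSup_le fun p => by
    rw [map_smul_eq_mul]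
    exact mul_le_mul_of_nonneg_left (le_maxNorm p.2 a) (norm_nonneg z)

theorem norm_star' (a : FreeUnitaryAlgebra Φ) : ‖star a‖ = ‖a‖ := by
  simp only [norm_def, maxNorm]
  exact iSup_congr fun p => p.2.star_eq a

theorem norm_mul_self_le' (a : FreeUnitaryAlgebra Φ) : ‖a‖ * ‖a‖ ≤ ‖star a * a‖ := by
  have h : ‖a‖ ≤ √‖star a * a‖ := ciSup_le fun p => by
    refine Real.le_sqrt_of_sq_le ?_
    rw [sq, ← p.2.star_mul_self]
    exact le_maxNorm p.2 _
  calc ‖a‖ * ‖a‖ ≤ √‖star a * a‖ * √‖star a * a‖ :=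
        mul_self_le_mul_self (norm_nonneg a) h
    _ = ‖star a * a‖ := Real.mul_self_sqrt (norm_nonneg _)

instance : NormedStarGroup (FreeUnitaryAlgebra Φ) := ⟨fun a => (norm_star' a).le⟩

end FreeUnitaryAlgebra

open UniformSpace

/-- The rotation algebra: the universal C*-algebra generated by two unitaries `u`, `v` with
`u v = exp (-i Φ) v u`, that is, the Hausdorff completion of the free `*`-algebra on two unitaries
for the largest C*-seminorm compatible with the relation. -/
abbrev RotationAlgebra (Φ : ℝ) : Type := Completion (FreeUnitaryAlgebra Φ)

namespace RotationAlgebra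

variable {Φ : ℝ}

instance : Star (RotationAlgebra Φ) := ⟨Completion.map star⟩

theorem uniformContinuous_star' :
    UniformContinuous (star : FreeUnitaryAlgebra Φ → FreeUnitaryAlgebra Φ) :=
  star_isometry.uniformContinuous

theorem continuous_star' : Continuous (star : RotationAlgebra Φ → RotationAlgebra Φ) :=
  Completion.continuous_map

theorem coe_star (a : FreeUnitaryAlgebra Φ) :
    ((star a : FreeUnitaryAlgebra Φ) : RotationAlgebra Φ) = star (a : RotationAlgebra Φ) :=
  (Completion.map_coe uniformContinuous_star' a).symm

instance : StarRing (RotationAlgebra Φ) where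
  star_involutive x := by
    induction x using Completion.induction_on with
    | hp => exact isClosed_eq (continuous_star'.comp continuous_star') continuous_id
    | ih a => rw [← coe_star, ← coe_star, star_star]
  star_mul x y := by
    induction x, y using Completion.induction_on₂ with
    | hp =>
      exact isClosed_eq (continuous_star'.comp continuous_mul)
        ((continuous_star'.comp continuous_snd).mul (continuous_star'.comp continuous_fst))
    | ih a b =>
      rw [← coe_star, ← coe_star, ← Completion.coe_mul, ← Completion.coe_mul, ← coe_star, star_mul]
  star_add x y := by
    induction x, y using Completion.induction_on₂ with
    | hp =>
      exact isClosed_eq (continuous_star'.comp continuous_add)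
        ((continuous_star'.comp continuous_fst).add (continuous_star'.comp continuous_snd))
    | ih a b =>
      rw [← coe_star, ← coe_star, ← Completion.coe_add, ← Completion.coe_add, ← coe_star, star_add]

instance : StarModule ℂ (RotationAlgebra Φ) where
  star_smul z x := by
    induction x using Completion.induction_on with
    | hp =>
      exact isClosed_eq (continuous_star'.comp (continuous_const_smul z))
        (continuous_star'.const_smul (star z))
    | ih a => rw [← coe_star, ← Completion.coe_smul, ← Completion.coe_smul, ← coe_star, star_smul]

instance : CStarRing (RotationAlgebra Φ) where
  norm_mul_self_le x := by
    induction x using Completion.induction_on with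
    | hp =>
      exact isClosed_le (continuous_norm.mul continuous_norm)
        (continuous_norm.comp (continuous_star'.mul continuous_id))
    | ih a =>
      rw [← coe_star, ← Completion.coe_mul, Completion.norm_coe, Completion.norm_coe]
      exact FreeUnitaryAlgebra.norm_mul_self_le' a

instance : NormedAlgebra ℂ (RotationAlgebra Φ) where
  norm_smul_le := norm_smul_le

instance : CStarAlgebra (RotationAlgebra Φ) where

/-- The generator `u` (for `i = 0`) or `v` (for `i = 1`). -/
def gen (Φ : ℝ) (i : Fin 2) : RotationAlgebra Φ := (FreeUnitaryAlgebra.gen Φ i : RotationAlgebra Φ)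

/-- The generator `u`. -/
def u (Φ : ℝ) : RotationAlgebra Φ := gen Φ 0

/-- The generator `v`. -/
def v (Φ : ℝ) : RotationAlgebra Φ := gen Φ 1

theorem gen_mem_unitary (i : Fin 2) : gen Φ i ∈ unitary (RotationAlgebra Φ) := by
  rw [Unitary.mem_iff, gen, ← coe_star, ← Completion.coe_mul, ← Completion.coe_mul,
    FreeUnitaryAlgebra.gen, FreeUnitaryAlgebra.star_mono, FreeUnitaryAlgebra.mono_mul,
    FreeUnitaryAlgebra.mono_mul]
  simp [← FreeUnitaryAlgebra.one_eq_mono, Completion.coe_one]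

theorem u_mul_v : u Φ * v Φ = Complex.exp (-(Φ * Complex.I)) • (v Φ * u Φ) := by
  rw [← sub_eq_zero, ← norm_eq_zero, u, v, gen, gen, ← Completion.coe_mul, ← Completion.coe_mul,
    ← Completion.coe_smul, ← Completion.coe_sub, Completion.norm_coe]
  refine le_antisymm (ciSup_le fun p => p.2.relation.le) (norm_nonneg _)

section Lift

variable {B : Type*} [CStarAlgebra B] (U V : unitary B)

/-- The `*`-homomorphism on the free `*`-algebra with `u ↦ U`, `v ↦ V`. -/
def preLift (Φ : ℝ) : FreeUnitaryAlgebra Φ →ₐ[ℂ] B :=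
  MonoidAlgebra.lift ℂ B (FreeGroup (Fin 2))
    ((unitary B).subtype.comp (FreeGroup.lift ![U, V]))

theorem preLift_mono (g : FreeGroup (Fin 2)) (c : ℂ) :
    preLift U V Φ (FreeUnitaryAlgebra.mono Φ g c) = c • (FreeGroup.lift ![U, V] g : B) :=
  MonoidAlgebra.lift_single ..

theorem preLift_gen (i : Fin 2) :
    preLift U V Φ (FreeUnitaryAlgebra.gen Φ i) = (![U, V] i : B) := by
  rw [FreeUnitaryAlgebra.gen, preLift_mono, one_smul, FreeGroup.lift_apply_of]

theorem preLift_star (a : FreeUnitaryAlgebra Φ) :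
    preLift U V Φ (star a) = star (preLift U V Φ a) := by
  induction a using FreeUnitaryAlgebra.mono_induction with
  | h0 => simp
  | hadd a b ha hb => simp [ha, hb]
  | hmono g c =>
    rw [FreeUnitaryAlgebra.star_mono, preLift_mono, preLift_mono, star_smul, map_inv,
      ← Unitary.star_eq_inv, Unitary.coe_star]
    rfl

theorem norm_preLift_le
    (h : (U * V : B) = Complex.exp (-(Φ * Complex.I)) • (V * U : B))
    (a : FreeUnitaryAlgebra Φ) : ‖preLift U V Φ a‖ ≤ ‖a‖ := by
  let p : Seminorm ℂ (FreeUnitaryAlgebra Φ) := (normSeminorm ℂ B).comp (preLift U V Φ).toLinearMap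
  have hp : FreeUnitaryAlgebra.IsRotationSeminorm Φ p :=
    { mul_le := fun a b => by
        change ‖preLift U V Φ (a * b)‖ ≤ ‖preLift U V Φ a‖ * ‖preLift U V Φ b‖
        rw [map_mul]
        exact norm_mul_le _ _
      star_mul_self := fun a => by
        change ‖preLift U V Φ (star a * a)‖ = ‖preLift U V Φ a‖ * ‖preLift U V Φ a‖
        rw [map_mul, preLift_star, CStarRing.norm_star_mul_self]
      relation := by
        change ‖preLift U V Φ _‖ = 0
        rw [map_sub, map_smul, map_mul, map_mul, preLift_gen, preLift_gen, norm_eq_zero,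
          sub_eq_zero]
        exact h }
  exact FreeUnitaryAlgebra.le_maxNorm hp a

/-- The universal property: unitaries `U`, `V` of a C*-algebra with `U V = exp (-i Φ) V U` define a
`*`-homomorphism with `u ↦ U` and `v ↦ V`. -/
def lift (h : (U * V : B) = Complex.exp (-(Φ * Complex.I)) • (V * U : B)) :
    RotationAlgebra Φ →⋆ₐ[ℂ] B :=
  have hc : Continuous (preLift U V Φ) :=
    AddMonoidHomClass.continuous_of_bound (preLift U V Φ) 1
      fun a => by simpa using norm_preLift_le U V h a
  { Completion.extensionHom (preLift U V Φ : FreeUnitaryAlgebra Φ →+* B) hc with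
    commutes' := fun z => by
      change Completion.extensionHom _ hc
        ((algebraMap ℂ (FreeUnitaryAlgebra Φ) z : FreeUnitaryAlgebra Φ) : RotationAlgebra Φ) = _
      rw [Completion.extensionHom_coe]
      exact (preLift U V Φ).commutes z
    map_star' := fun x => by
      change Completion.extensionHom _ hc (star x) = star (Completion.extensionHom _ hc x)
      have hc' : Continuous
          (Completion.extensionHom (preLift U V Φ : FreeUnitaryAlgebra Φ →+* B) hc) :=
        Completion.continuous_extension
      induction x using Completion.induction_on with
      | hp => exact isClosed_eq (hc'.comp continuous_star') (ContinuousStar.continuous_star.comp hc')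
      | ih a =>
        rw [← coe_star, Completion.extensionHom_coe, Completion.extensionHom_coe]
        exact preLift_star U V a }

theorem lift_coe (h : (U * V : B) = Complex.exp (-(Φ * Complex.I)) • (V * U : B))
    (a : FreeUnitaryAlgebra Φ) : lift U V h (a : RotationAlgebra Φ) = preLift U V Φ a :=
  Completion.extensionHom_coe (preLift U V Φ : FreeUnitaryAlgebra Φ →+* B)
    (AddMonoidHomClass.continuous_of_bound (preLift U V Φ) 1
      fun a => by simpa using norm_preLift_le U V h a) a

theorem lift_u (h : (U * V : B) = Complex.exp (-(Φ * Complex.I)) • (V * U : B)) :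
    lift U V h (u Φ) = U := by
  rw [u, gen, lift_coe, preLift_gen]; rfl

theorem lift_v (h : (U * V : B) = Complex.exp (-(Φ * Complex.I)) • (V * U : B)) :
    lift U V h (v Φ) = V := by
  rw [v, gen, lift_coe, preLift_gen]; rfl

end Lift

/-- A `*`-homomorphism from the rotation algebra is determined by the images of `u` and `v`. -/
theorem hom_ext {B : Type*} [CStarAlgebra B] {f g : RotationAlgebra Φ →⋆ₐ[ℂ] B}
    (hu : f (u Φ) = g (u Φ)) (hv : f (v Φ) = g (v Φ)) : f = g := by
  have hgen : ∀ i, f (gen Φ i) = g (gen Φ i) := by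
    intro i
    fin_cases i
    exacts [hu, hv]
  have hmon : ∀ w : FreeGroup (Fin 2),
      f (FreeUnitaryAlgebra.mono Φ w 1 : RotationAlgebra Φ) =
        g (FreeUnitaryAlgebra.mono Φ w 1 : RotationAlgebra Φ) := by
    intro w
    induction w using FreeGroup.induction_on with
    | C1 => rw [← FreeUnitaryAlgebra.one_eq_mono, Completion.coe_one, map_one, map_one]
    | of i => exact hgen i
    | inv_of i _ =>
      have hi : (FreeUnitaryAlgebra.mono Φ (FreeGroup.of i)⁻¹ 1 : RotationAlgebra Φ)
          = star (gen Φ i) := by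
        rw [gen, ← coe_star, FreeUnitaryAlgebra.gen, FreeUnitaryAlgebra.star_mono, map_one]
      exact (congrArg f hi).trans (((map_star f _).trans
        ((congrArg star (hgen i)).trans (map_star g _).symm)).trans (congrArg g hi).symm)
    | mul x y hx hy =>
      rw [← mul_one (1 : ℂ), ← FreeUnitaryAlgebra.mono_mul, Completion.coe_mul, map_mul, map_mul,
        hx, hy]
  have hf : Continuous f := by
    exact AddMonoidHomClass.continuous_of_bound f 1
      fun a => by simpa using NonUnitalStarAlgHom.norm_apply_le f a
  have hg : Continuous g := by
    exact AddMonoidHomClass.continuous_of_bound g 1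
      fun a => by simpa using NonUnitalStarAlgHom.norm_apply_le g a
  ext x
  induction x using Completion.induction_on with
  | hp => exact isClosed_eq hf hg
  | ih a =>
    induction a using FreeUnitaryAlgebra.mono_induction with
    | h0 => rw [Completion.coe_zero, map_zero, map_zero]
    | hadd a b ha hb => rw [Completion.coe_add, map_add, map_add, ha, hb]
    | hmono w c =>
      rw [← mul_one c, ← FreeUnitaryAlgebra.smul_mono, Completion.coe_smul, map_smul, map_smul,
        hmon]

end RotationAlgebra

/-- A C*-algebra is simple if it is nonzero and its only closed two-sided ideals are the trivial
ones. -/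
def IsSimpleCStarAlgebra (A : Type*) [CStarAlgebra A] : Prop :=
  Nontrivial A ∧ ∀ I : TwoSidedIdeal A, IsClosed (I : Set A) → I = ⊥ ∨ I = ⊤

/-! ### Operators on `ℓ²(X)` and on `ℓ²(X) ⊗ ℂ²` -/

/-- The Hilbert space `ℓ²(X)`. -/
abbrev L2 (X : Type) : Type := lp (fun _ : X => ℂ) 2

/-- The Hilbert space `ℓ²(X) ⊗ ℂ²`, as the orthogonal sum of two copies of `ℓ²(X)`. The internal
states `+1` and `-1` are the indices `0` and `1`: the coordinate `ψ(x, s)` is `ψ s x`. -/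
abbrev SpinL2 (X : Type) : Type := PiLp 2 fun _ : Fin 2 => L2 X

section Operators

variable {X : Type}

theorem memℓp_shift (e : X ≃ X) (U : X → Circle) (ψ : L2 X) :
    Memℓp (fun x => (U x : ℂ) * ψ (e x)) 2 := by
  have h : Summable fun x => ‖ψ x‖ ^ (2 : ENNReal).toReal := (lp.memℓp ψ).summable (by simp)
  refine memℓp_gen ?_
  simpa [Function.comp_def, Circle.norm_coe] using e.summable_iff.2 h

/-- The isometric isomorphism of `ℓ²(X)` with `|x⟩ ↦ U(x) |e x⟩`. -/
def weightedShiftEquiv (e : X ≃ X) (U : X → Circle) : L2 X ≃ₗᵢ[ℂ] L2 X where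
  toFun ψ := ⟨fun x => U (e.symm x) * ψ (e.symm x), memℓp_shift e.symm (U ∘ e.symm) ψ⟩
  invFun ψ := ⟨fun x => (U x)⁻¹ * ψ (e x), by
    have h := memℓp_shift e (fun x => (U x)⁻¹) ψ
    simp only [Circle.coe_inv] at h
    exact h⟩
  map_add' ψ φ := by ext x; exact mul_add _ _ _
  map_smul' z ψ := by ext x; simp [mul_left_comm]
  left_inv ψ := by ext x; simp
  right_inv ψ := by ext x; simp
  norm_map' ψ := by
    have h2 : 0 < (2 : ENNReal).toReal := by simp
    rw [lp.norm_eq_tsum_rpow h2, lp.norm_eq_tsum_rpow h2, ← e.symm.tsum_eq fun x => ‖ψ x‖ ^ _]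
    simp [Circle.norm_coe]

/-- The unitary operator on `ℓ²(X)` with `|x⟩ ↦ U(x) |e x⟩`. -/
def weightedShift (e : X ≃ X) (U : X → Circle) : unitary (L2 X →L[ℂ] L2 X) :=
  Unitary.linearIsometryEquiv.symm (weightedShiftEquiv e U)

theorem weightedShift_apply (e : X ≃ X) (U : X → Circle) (ψ : L2 X) (x : X) :
    (weightedShift e U : L2 X →L[ℂ] L2 X) ψ x = U (e.symm x) * ψ (e.symm x) := rfl

theorem weightedShift_single [DecidableEq X] (e : X ≃ X) (U : X → Circle) (x : X) :
    (weightedShift e U : L2 X →L[ℂ] L2 X) (lp.single 2 x 1) =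
      (U x : ℂ) • lp.single 2 (e x) (1 : ℂ) := by
  ext y
  rw [weightedShift_apply, lp.coeFn_smul, Pi.smul_apply, smul_eq_mul]
  by_cases h : y = e x
  · subst h
    simp
  · have h' : e.symm y ≠ x := fun h' => h (by rw [← h', e.apply_symm_apply])
    rw [lp.single_apply_ne _ _ _ h', lp.single_apply_ne _ _ _ h, mul_zero, mul_zero]

/-- The multiplication operator `|x⟩ ↦ c(x) |x⟩` for a function `c` that is bounded by one. -/
def mulOp (c : X → ℂ) (hc : ∀ x, ‖c x‖ ≤ 1) : L2 X →L[ℂ] L2 X :=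
  lp.mapCLM 2 (fun x => c x • ContinuousLinearMap.id ℂ ℂ) zero_le_one
    (fun x => by simpa [norm_smul] using hc x)

theorem mulOp_apply (c : X → ℂ) (hc : ∀ x, ‖c x‖ ≤ 1) (ψ : L2 X) (x : X) :
    mulOp c hc ψ x = c x * ψ x := by
  simp [mulOp]

/-- The operator with `(M ψ) i = ∑ j, M i j (ψ j)`. -/
def blockFun (M : Matrix (Fin 2) (Fin 2) (L2 X →L[ℂ] L2 X)) : SpinL2 X →L[ℂ] SpinL2 X :=
  (PiLp.continuousLinearEquiv 2 ℂ fun _ : Fin 2 => L2 X).symm.toContinuousLinearMap ∘L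
    ContinuousLinearMap.pi fun i => ∑ j, M i j ∘L PiLp.proj 2 (fun _ : Fin 2 => L2 X) j

theorem blockFun_apply (M : Matrix (Fin 2) (Fin 2) (L2 X →L[ℂ] L2 X)) (ψ : SpinL2 X) (i : Fin 2) :
    blockFun M ψ i = ∑ j, M i j (ψ j) := by
  simp [blockFun]

theorem blockFun_ext {S T : SpinL2 X →L[ℂ] SpinL2 X} (h : ∀ ψ i, S ψ i = T ψ i) : S = T :=
  ContinuousLinearMap.ext fun ψ => PiLp.ext fun i => h ψ i

/-- The operator on `ℓ²(X) ⊗ ℂ²` given by a `2 × 2` matrix of operators on `ℓ²(X)`, that is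
`∑ i j, e i j ⊗ M i j`. -/
def blockOp : Matrix (Fin 2) (Fin 2) (L2 X →L[ℂ] L2 X) →⋆ₐ[ℂ] (SpinL2 X →L[ℂ] SpinL2 X) where
  toFun := blockFun
  map_one' := blockFun_ext fun ψ i => by
    rw [blockFun_apply]
    simp only [Matrix.one_apply, Fin.sum_univ_two]
    fin_cases i <;> simp
  map_mul' M N := blockFun_ext fun ψ i => by
    rw [mul_apply_eq_comp]
    simp only [blockFun_apply, Matrix.mul_apply, Fin.sum_univ_two, add_apply,
      mul_apply_eq_comp, map_add]
    abel
  map_zero' := blockFun_ext fun ψ i => by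
    rw [blockFun_apply]
    simp
  map_add' M N := blockFun_ext fun ψ i => by
    rw [add_apply, PiLp.add_apply]
    simp only [blockFun_apply, Matrix.add_apply, Fin.sum_univ_two, add_apply]
    abel
  commutes' z := blockFun_ext fun ψ i => by
    rw [blockFun_apply]
    fin_cases i <;> simp [Algebra.algebraMap_eq_smul_one]
  map_star' M := by
    rw [ContinuousLinearMap.star_eq_adjoint, ContinuousLinearMap.eq_adjoint_iff]
    intro ψ φ
    simp only [PiLp.inner_apply, blockFun_apply, Fin.sum_univ_two, Matrix.star_apply, inner_add_left,
      inner_add_right, ContinuousLinearMap.star_eq_adjoint, ContinuousLinearMap.adjoint_inner_left]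
    ring

theorem blockOp_apply (M : Matrix (Fin 2) (Fin 2) (L2 X →L[ℂ] L2 X)) (ψ : SpinL2 X) (i : Fin 2) :
    blockOp M ψ i = ∑ j, M i j (ψ j) :=
  blockFun_apply M ψ i

/-- The coin operator `⨁ₓ C(x)`, acting by the unitary matrix `C(x)` on the internal degree of
freedom at the site `x`. -/
def coinOp (C : X → Matrix.unitaryGroup (Fin 2) ℂ) : SpinL2 X →L[ℂ] SpinL2 X :=
  blockOp (Matrix.of fun s t => mulOp (fun x => (C x : Matrix (Fin 2) (Fin 2) ℂ) s t)
    fun x => entry_norm_bound_of_unitary (C x).2 s t)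

theorem coinOp_apply (C : X → Matrix.unitaryGroup (Fin 2) ℂ) (ψ : SpinL2 X) (s : Fin 2) (x : X) :
    coinOp C ψ s x = ∑ t, (C x : Matrix (Fin 2) (Fin 2) ℂ) s t * ψ t x := by
  simp [coinOp, blockOp_apply, mulOp_apply]

/-- The state-dependent shift `∑ s, T ^ s ⊗ P s` for a unitary operator `T` on `ℓ²(X)`. -/
def stateShift (T : unitary (L2 X →L[ℂ] L2 X)) : SpinL2 X →L[ℂ] SpinL2 X :=
  blockOp !![(T : L2 X →L[ℂ] L2 X), 0; 0, star (T : L2 X →L[ℂ] L2 X)]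

end Operators

/-! ### The two walks -/

/-- The Hadamard matrix. -/
def hadamard : Matrix.unitaryGroup (Fin 2) ℂ :=
  ⟨((1 / √2 : ℝ) : ℂ) • !![1, 1; 1, -1], by
    have h : ((√2 : ℝ) : ℂ) * ((√2 : ℝ) : ℂ) = 2 := by
      rw [← Complex.ofReal_mul, Real.mul_self_sqrt (by norm_num)]
      norm_num
    have h0 : ((√2 : ℝ) : ℂ) ≠ 0 := by
      intro h0
      simp [h0] at h
    rw [Matrix.mem_unitaryGroup_iff]
    ext i j
    fin_cases i <;> fin_cases j <;>
      simp [Matrix.mul_apply, Fin.sum_univ_two, Matrix.star_apply] <;> field_simp <;>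
      rw [sq, h] <;> norm_num⟩

/-- The magnetic translation `T₁ |x⟩ = exp (-i x₂ Φ / 2) |x + e₁⟩` in the symmetric gauge. -/
def magT1 (Φ : ℝ) : unitary (L2 (ℤ × ℤ) →L[ℂ] L2 (ℤ × ℤ)) :=
  weightedShift (Equiv.addRight (1, 0)) fun x => Circle.exp (-(x.2 * Φ / 2))

/-- The magnetic translation `T₂ |x⟩ = exp (i x₁ Φ / 2) |x + e₂⟩` in the symmetric gauge. -/
def magT2 (Φ : ℝ) : unitary (L2 (ℤ × ℤ) →L[ℂ] L2 (ℤ × ℤ)) :=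
  weightedShift (Equiv.addRight (0, 1)) fun x => Circle.exp (x.1 * Φ / 2)

/-- The magnetic walk `W_Φ` on `ℓ²(ℤ²) ⊗ ℂ²`. -/
def magneticWalk (Φ : ℝ) : SpinL2 (ℤ × ℤ) →L[ℂ] SpinL2 (ℤ × ℤ) :=
  stateShift (magT1 Φ) * coinOp (fun _ => hadamard) *
    stateShift (magT2 Φ) * coinOp (fun _ => hadamard)

/-- The translation `|x⟩ ↦ |x + 1⟩` of `ℓ²(ℤ)`. -/
def translation : unitary (L2 ℤ →L[ℂ] L2 ℤ) := weightedShift (Equiv.addRight 1) fun _ => 1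

/-- The phase multiplication `|x⟩ ↦ exp (i (x Φ + θ)) |x⟩` of `ℓ²(ℤ)`. -/
def phase (Φ θ : ℝ) : unitary (L2 ℤ →L[ℂ] L2 ℤ) :=
  weightedShift (Equiv.refl ℤ) fun x => Circle.exp (x * Φ + θ)

/-- The rotation matrix with angle `α`. -/
def rotation (α : ℝ) : Matrix.unitaryGroup (Fin 2) ℂ :=
  ⟨!![(Real.cos α : ℂ), -(Real.sin α : ℂ); (Real.sin α : ℂ), (Real.cos α : ℂ)], by
    have h : ((Real.cos α : ℝ) : ℂ) * (Real.cos α : ℝ) + (Real.sin α : ℝ) * (Real.sin α : ℝ) = 1 := by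
      exact_mod_cast (by nlinarith [Real.sin_sq_add_cos_sq α] :
        Real.cos α * Real.cos α + Real.sin α * Real.sin α = 1)
    rw [Matrix.mem_unitaryGroup_iff]
    ext i j
    fin_cases i <;> fin_cases j <;>
      simp only [Matrix.mul_apply, Fin.sum_univ_two, Matrix.star_apply] <;>
      simp [-Complex.ofReal_cos, -Complex.ofReal_sin] <;> first | linear_combination h | ring⟩

/-- The unitary critical almost Mathieu operator `S C₂(Φ)` on `ℓ²(ℤ) ⊗ ℂ²` with phase `θ`. -/
def almostMathieuWalk (Φ θ : ℝ) : SpinL2 ℤ →L[ℂ] SpinL2 ℤ :=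
  stateShift translation * coinOp fun x : ℤ => rotation (Φ * x + θ)

/-! ### The abstract walk and its two representations -/

/-- The element `diag(u, u*) C_H diag(v, v*) C_H` of `M₂(A_Φ)`. -/
def abstractWalk (Φ : ℝ) : Matrix (Fin 2) (Fin 2) (RotationAlgebra Φ) :=
  !![RotationAlgebra.u Φ, 0; 0, star (RotationAlgebra.u Φ)] *
    (hadamard : Matrix (Fin 2) (Fin 2) ℂ).map (algebraMap ℂ (RotationAlgebra Φ)) *
    !![RotationAlgebra.v Φ, 0; 0, star (RotationAlgebra.v Φ)] *
    (hadamard : Matrix (Fin 2) (Fin 2) ℂ).map (algebraMap ℂ (RotationAlgebra Φ))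

/-- The lift of a representation `π` of `A_Φ` on `ℓ²(X)` to the representation
`a ↦ ∑ i j, e i j ⊗ π (a i j)` of `M₂(A_Φ)` on `ℓ²(X) ⊗ ℂ²`. -/
def liftRep {Φ : ℝ} {X : Type} (π : RotationAlgebra Φ →⋆ₐ[ℂ] (L2 X →L[ℂ] L2 X)) :
    Matrix (Fin 2) (Fin 2) (RotationAlgebra Φ) →⋆ₐ[ℂ] (SpinL2 X →L[ℂ] SpinL2 X) :=
  blockOp.comp
    { AlgHom.mapMatrix (π : RotationAlgebra Φ →ₐ[ℂ] (L2 X →L[ℂ] L2 X)) with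
      map_star' := fun a => by
        ext i j : 1
        exact map_star π (a j i) }

theorem magT1_mul_magT2 (Φ : ℝ) :
    (magT1 Φ * magT2 Φ : L2 (ℤ × ℤ) →L[ℂ] L2 (ℤ × ℤ)) =
      Complex.exp (-(Φ * Complex.I)) • (magT2 Φ * magT1 Φ : L2 (ℤ × ℤ) →L[ℂ] L2 (ℤ × ℤ)) := by
  ext ψ x
  simp only [magT1, magT2, mul_apply_eq_comp, smul_apply,
    lp.coeFn_smul, Pi.smul_apply, weightedShift_apply, smul_eq_mul, Circle.coe_exp,
    Equiv.addRight_symm, Equiv.coe_addRight, ← mul_assoc, ← Complex.exp_add, add_assoc]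
  rw [add_comm (-((0, 1) : ℤ × ℤ))]
  congr 2
  simp
  ring

theorem translation_mul_phase (Φ θ : ℝ) :
    (translation * phase Φ θ : L2 ℤ →L[ℂ] L2 ℤ) =
      Complex.exp (-(Φ * Complex.I)) • (phase Φ θ * translation : L2 ℤ →L[ℂ] L2 ℤ) := by
  ext ψ x
  simp only [translation, phase, mul_apply_eq_comp, smul_apply,
    lp.coeFn_smul, Pi.smul_apply, weightedShift_apply, smul_eq_mul, Circle.coe_exp, Circle.coe_one,
    one_mul, Equiv.addRight_symm, Equiv.coe_addRight, Equiv.refl_symm, Equiv.refl_apply,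
    ← mul_assoc, ← Complex.exp_add]
  congr 2
  push_cast
  ring

/-- The representation of `A_Φ` on `ℓ²(ℤ²)` with `u ↦ T₁` and `v ↦ T₂`. -/
def rep2 (Φ : ℝ) : RotationAlgebra Φ →⋆ₐ[ℂ] (L2 (ℤ × ℤ) →L[ℂ] L2 (ℤ × ℤ)) :=
  RotationAlgebra.lift (magT1 Φ) (magT2 Φ) (magT1_mul_magT2 Φ)

/-- The representation of `A_Φ` on `ℓ²(ℤ)` with `u |x⟩ = |x + 1⟩` and
`v |x⟩ = exp (i (x Φ + θ)) |x⟩`. -/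
def rep1 (Φ θ : ℝ) : RotationAlgebra Φ →⋆ₐ[ℂ] (L2 ℤ →L[ℂ] L2 ℤ) :=
  RotationAlgebra.lift translation (phase Φ θ) (translation_mul_phase Φ θ)

end MagneticWalk

end

noncomputable section
namespace MagneticWalk

open UniformSpace Filter Topology
open scoped Pointwise

/-! ### Words in two group elements that commute up to a central element -/

section Words

variable {H : Type*} [Group H] {z u v : H}

/-! Once the rotation algebra is known to be simple, each of its representations on a nonzero space
is faithful, and so is the amplification to 2 × 2 matrices. Injective `*`-homomorphisms of
C*-algebras preserve spectra, so Π₁(w) and Π₂(w) both have the spectrum of w (`spectrum_liftRep`).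
The magnetic walk is Π₂(w) by inspection, and conjugation by the constant coin diag(1, -i) turns
Π₁(w) into the almost Mathieu walk (`almostMathieuWalk_mul_phaseCoin`).

Simplicity comes from averaging over inner automorphisms. Every word in u, v is an eigenvector of
conjugation by u^i v^j, with a power of exp(-iΦ) as eigenvalue (`conjAut_word`). By irrationality
the averages of a nonscalar word tend to 0, so averages of any element come arbitrarily close to
scalars (`exists_genAverage_near_scalar`). Averages of an element of an ideal stay in the ideal; if
it is proper, a Neumann series makes the scalars, hence these averages, small
(`norm_le_norm_sub_smul_one`).

On the other hand, the orbit of a positive x under these conjugations is totally bounded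
(`exists_finite_net`), so up to ε it is dominated by a finite sum of conjugates of its average
(`norm_le_of_finite_net`). This plays the role of a faithful trace: with x = a* a, every element a
of a proper ideal vanishes. -/

theorem zpow_mul_zpow_of_central (hz : ∀ h, Commute z h) (huv : u * v = z * (v * u)) (l k : ℤ) :
    v ^ l * u ^ k = z ^ (-(l * k)) * (u ^ k * v ^ l) := by
  -- Conjugation by u scales v by z, hence v ^ l by z ^ l. Read from the other side, conjugation by
  -- v ^ l scales u by z ^ (-l), hence u ^ k by z ^ (-(l * k)).
  have h1 : u * v * u⁻¹ = z * v := by rw [huv]; group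
  have h2 : u * v ^ l * u⁻¹ = z ^ l * v ^ l := by
    rw [← conj_zpow, h1, (hz v).mul_zpow]
  have h3 : v ^ l * u * (v ^ l)⁻¹ = z ^ (-l) * u := by
    have h4 : u * v ^ l = z ^ l * (v ^ l * u) := by
      rw [← mul_assoc, ← h2]; group
    rw [mul_inv_eq_iff_eq_mul, mul_assoc, h4, ← mul_assoc, ← zpow_add]
    simp
  have h5 : v ^ l * u ^ k * (v ^ l)⁻¹ = z ^ (-(l * k)) * u ^ k := by
    rw [← conj_zpow, h3, ((hz u).zpow_left _).mul_zpow, ← zpow_mul, neg_mul]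
  rw [← mul_assoc, ← h5]
  group

theorem normalForm_mul (hz : ∀ h, Commute z h) (huv : u * v = z * (v * u)) (a k l b i j : ℤ) :
    z ^ a * u ^ k * v ^ l * (z ^ b * u ^ i * v ^ j) =
      z ^ (a + b - l * i) * u ^ (k + i) * v ^ (l + j) := by
  calc z ^ a * u ^ k * v ^ l * (z ^ b * u ^ i * v ^ j)
      = z ^ a * u ^ k * (v ^ l * z ^ b) * u ^ i * v ^ j := by group
    _ = z ^ a * (u ^ k * z ^ b) * (v ^ l * u ^ i) * v ^ j := by
        rw [((hz (v ^ l)).zpow_left b).eq.symm]; group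
    _ = z ^ a * z ^ b * (u ^ k * z ^ (-(l * i))) * (u ^ i * v ^ l) * v ^ j := by
        rw [((hz (u ^ k)).zpow_left b).eq.symm, zpow_mul_zpow_of_central hz huv]; group
    _ = z ^ (a + b - l * i) * u ^ (k + i) * v ^ (l + j) := by
        rw [((hz (u ^ k)).zpow_left _).eq.symm, sub_eq_add_neg]
        simp only [zpow_add, mul_assoc]

theorem exists_normalForm (hz : ∀ h, Commute z h) (huv : u * v = z * (v * u))
    (w : FreeGroup (Fin 2)) :
    ∃ a k l : ℤ, FreeGroup.lift ![u, v] w = z ^ a * u ^ k * v ^ l := by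
  induction w using FreeGroup.induction_on with
  | C1 => exact ⟨0, 0, 0, by simp⟩
  | of i =>
    fin_cases i
    exacts [⟨0, 1, 0, by simp⟩, ⟨0, 0, 1, by simp⟩]
  | inv_of i _ =>
    fin_cases i
    exacts [⟨0, -1, 0, by simp⟩, ⟨0, 0, -1, by simp⟩]
  | mul x y hx hy =>
    obtain ⟨a, k, l, hx⟩ := hx
    obtain ⟨b, i, j, hy⟩ := hy
    exact ⟨_, _, _, by rw [map_mul, hx, hy, normalForm_mul hz huv]⟩

/-- The two orders of the product differ only in the exponent of z, by the symplectic form i * l - j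
* k; a and b cancel. So words are eigenvectors of conjugation once z is a scalar. -/
theorem normalForm_conj (hz : ∀ h, Commute z h) (huv : u * v = z * (v * u)) (a k l b i j : ℤ) :
    z ^ b * u ^ i * v ^ j * (z ^ a * u ^ k * v ^ l) * (z ^ b * u ^ i * v ^ j)⁻¹ =
      z ^ (i * l - j * k) * (z ^ a * u ^ k * v ^ l) := by
  rw [mul_inv_eq_iff_eq_mul, mul_assoc (z ^ (i * l - j * k)), normalForm_mul hz huv,
    normalForm_mul hz huv, mul_assoc, mul_assoc, ← mul_assoc (z ^ _) (z ^ _), ← zpow_add,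
    add_comm i, add_comm j]
  congr 2
  ring

end Words

/-! ### Averages of powers of a complex number of modulus one -/

open Classical in
-- For z ≠ 1 the geometric sums are bounded by 2 / ‖z - 1‖, and the factor n⁻¹ sends them to 0.
theorem tendsto_average_pow_circle (z : Circle) :
    Tendsto (fun n : ℕ => (n : ℂ)⁻¹ * ∑ i ∈ Finset.range n, (z : ℂ) ^ i) atTop
      (𝓝 (if z = 1 then 1 else 0)) := by
  split_ifs with hz
  · subst hz
    refine tendsto_const_nhds.congr' ?_
    filter_upwards [eventually_ne_atTop 0] with n hn
    simp [hn]
  · have hz' : (z : ℂ) - 1 ≠ 0 := sub_ne_zero.2 fun h => hz (by ext; simpa using h)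
    have hlim : Tendsto (fun n : ℕ => (n : ℝ)⁻¹ * (2 / ‖(z : ℂ) - 1‖)) atTop (𝓝 0) := by
      simpa using (tendsto_inv_atTop_zero.comp tendsto_natCast_atTop_atTop).mul_const
        (2 / ‖(z : ℂ) - 1‖)
    refine squeeze_zero_norm (fun n => ?_) hlim
    rw [geom_sum_eq (sub_ne_zero.1 hz'), norm_mul, norm_inv, Complex.norm_natCast, norm_div]
    gcongr
    refine (norm_sub_le _ _).trans ?_
    simp only [norm_pow, Circle.norm_coe, one_pow, norm_one]
    norm_num

/-! ### Inner automorphisms and their averages -/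

section Average

variable {A : Type*} [CStarAlgebra A]

/-- The unitary scalars. -/
def scalarUnitary (A : Type*) [CStarAlgebra A] : Circle →* unitary A where
  toFun z := ⟨algebraMap ℂ A z, by
    rw [Unitary.mem_iff, ← algebraMap_star_comm, ← map_mul, ← map_mul]
    simp [← Circle.coe_inv_eq_conj]⟩
  map_one' := by ext; simp
  map_mul' z w := by ext; simp

theorem scalarUnitary_mul (z : Circle) (g : unitary A) :
    ((scalarUnitary A z * g : unitary A) : A) = (z : ℂ) • (g : A) := by
  rw [Algebra.smul_def]; rfl

theorem commute_scalarUnitary (z : Circle) (g : unitary A) : Commute (scalarUnitary A z) g := by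
  ext
  exact Algebra.commutes (z : ℂ) (g : A)

/-- Conjugation by a unitary. -/
abbrev conjAut (g : unitary A) : A ≃⋆ₐ[ℂ] A := Unitary.conjStarAlgAut ℂ A g

/-- The average of the conjugates by `U ^ i * V ^ j` for `i, j < n`. -/
def average (U V : unitary A) (n : ℕ) (x : A) : A :=
  ((n : ℂ)⁻¹ * (n : ℂ)⁻¹) • ∑ i ∈ Finset.range n, ∑ j ∈ Finset.range n, conjAut (U ^ i * V ^ j) x

variable (U V : unitary A)

theorem norm_conjAut (g : unitary A) (x : A) : ‖conjAut g x‖ = ‖x‖ := by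
  exact NonUnitalStarAlgHom.norm_map (conjAut g) (conjAut g).injective x

theorem average_add (n : ℕ) (x y : A) :
    average U V n (x + y) = average U V n x + average U V n y := by
  simp [average, Finset.sum_add_distrib, smul_add]

theorem average_sub (n : ℕ) (x y : A) :
    average U V n (x - y) = average U V n x - average U V n y := by
  simp [average, Finset.sum_sub_distrib, smul_sub]

theorem average_smul (n : ℕ) (c : ℂ) (x : A) :
    average U V n (c • x) = c • average U V n x := by
  simp [average, Finset.smul_sum, smul_comm c]

theorem norm_average_le (n : ℕ) (x : A) : ‖average U V n x‖ ≤ ‖x‖ := by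
  -- The convention 0⁻¹ = 0 makes the average vanish for n = 0.
  rcases eq_or_ne n 0 with rfl | hn
  · simp [average]
  have hn' : (n : ℝ) ≠ 0 := by exact_mod_cast hn
  have h : ‖∑ i ∈ Finset.range n, ∑ j ∈ Finset.range n, conjAut (U ^ i * V ^ j) x‖
      ≤ n * (n * ‖x‖) := by
    refine (norm_sum_le_of_le _ fun i _ => norm_sum_le_of_le _ fun j _ =>
      (norm_conjAut _ x).le).trans ?_
    simp
  rw [average, norm_smul, norm_mul, norm_inv, Complex.norm_natCast]
  refine (mul_le_mul_of_nonneg_left h (by positivity)).trans_eq ?_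
  field_simp

theorem average_mem (I : TwoSidedIdeal A) (n : ℕ) {x : A} (hx : x ∈ I) : average U V n x ∈ I := by
  rw [average, Algebra.smul_def]
  refine I.mul_mem_left _ _ (sum_mem fun i _ => sum_mem fun j _ => ?_)
  rw [Unitary.conjStarAlgAut_apply]
  exact I.mul_mem_right _ _ (I.mul_mem_left _ _ hx)

/-- The eigenvalue is a product of a factor in i and a factor in j, so the double average splits
into two geometric averages. -/
theorem average_eq_of_conj {x : A} {z w : Circle}
    (h : ∀ i j : ℕ, conjAut (U ^ i * V ^ j) x = ((z : ℂ) ^ i * (w : ℂ) ^ j) • x) (n : ℕ) :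
    average U V n x = (((n : ℂ)⁻¹ * ∑ i ∈ Finset.range n, (z : ℂ) ^ i) *
      ((n : ℂ)⁻¹ * ∑ j ∈ Finset.range n, (w : ℂ) ^ j)) • x := by
  simp only [average, h, ← Finset.sum_smul, smul_smul]
  congr 1
  rw [mul_mul_mul_comm, Finset.sum_mul_sum]

end Average

/-! ### Positive elements are controlled by their averages -/

section Faithful

variable {A : Type*} [CStarAlgebra A] [Nontrivial A] (U V : unitary A)

/-- If s approximates U ^ i * V ^ j on x, then undoing the conjugation by s returns x up to ε. By
positivity the one conjugate involved is at most the sum over all of t, a bound uniform in i and j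
that can be averaged. -/
theorem norm_le_of_finite_net [PartialOrder A] [StarOrderedRing A] {x : A} (hx : 0 ≤ x) {ε : ℝ}
    (t : Finset (unitary A))
    (ht : ∀ i j : ℕ, ∃ s ∈ t, ‖conjAut (U ^ i * V ^ j) x - conjAut s x‖ < ε)
    {n : ℕ} (hn : n ≠ 0) : ‖x‖ ≤ ε + t.card * ‖average U V n x‖ := by
  have hε : 0 ≤ ε := by
    obtain ⟨s, -, hs⟩ := ht 0 0
    exact (norm_nonneg _).trans hs.le
  have hpos : ∀ g : unitary A, 0 ≤ conjAut g x := fun g => by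
    rw [Unitary.conjStarAlgAut_apply]
    exact star_right_conjugate_nonneg hx _
  have hsa : ∀ g : unitary A, IsSelfAdjoint (conjAut g x) := fun g => (hpos g).isSelfAdjoint
  have key : ∀ i j : ℕ,
      x ≤ algebraMap ℝ A ε + ∑ s ∈ t, conjAut s⁻¹ (conjAut (U ^ i * V ^ j) x) := by
    intro i j
    obtain ⟨s, hs, hlt⟩ := ht i j
    have h1 : conjAut s⁻¹ (conjAut (U ^ i * V ^ j) x) = conjAut (s⁻¹ * (U ^ i * V ^ j)) x := by
      simp [conjAut, map_mul]
    have h2 : ‖x - conjAut (s⁻¹ * (U ^ i * V ^ j)) x‖ ≤ ε := by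
      rw [← norm_conjAut s, map_sub, ← h1]
      have h3 : conjAut s (conjAut s⁻¹ (conjAut (U ^ i * V ^ j) x)) =
          conjAut (U ^ i * V ^ j) x := by
        simp only [conjAut, map_inv]
        exact StarAlgEquiv.apply_symm_apply _ _
      rw [h3, norm_sub_rev]
      exact hlt.le
    have h4 : x - conjAut (s⁻¹ * (U ^ i * V ^ j)) x ≤ algebraMap ℝ A ε := by
      have hxs : IsSelfAdjoint x := hx.isSelfAdjoint
      refine ((hxs.sub (hsa _)).le_algebraMap_norm_self).trans ?_
      exact algebraMap_mono A h2
    -- Enlarging to the whole sum removes the dependence on the s chosen for i and j.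
    have h5 : conjAut s⁻¹ (conjAut (U ^ i * V ^ j) x) ≤
        ∑ s ∈ t, conjAut s⁻¹ (conjAut (U ^ i * V ^ j) x) :=
      Finset.single_le_sum (f := fun s : unitary A => conjAut s⁻¹ (conjAut (U ^ i * V ^ j) x))
        (fun s _ => by
          have : conjAut s⁻¹ (conjAut (U ^ i * V ^ j) x) =
            conjAut (s⁻¹ * (U ^ i * V ^ j)) x := by simp [conjAut, map_mul]
          simp only [this]
          exact hpos _) hs
    rw [h1] at h5
    calc x = (x - conjAut (s⁻¹ * (U ^ i * V ^ j)) x) + conjAut (s⁻¹ * (U ^ i * V ^ j)) x := by simp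
      _ ≤ _ := add_le_add h4 h5
  have hn' : (n : ℝ) ≠ 0 := by exact_mod_cast hn
  have hnc : (n : ℂ) ≠ 0 := by exact_mod_cast hn
  -- Summing `key` over i, j < n and pulling the linear maps `conjAut s⁻¹` out of the sums leaves n²
  -- times the average.
  have hsum : ((n * n : ℕ) : ℝ) • x ≤ ((n * n : ℕ) : ℝ) • algebraMap ℝ A ε +
      ∑ s ∈ t, conjAut s⁻¹ (((n : ℂ) * n) • average U V n x) := by
    have h := Finset.sum_le_sum fun i (_ : i ∈ Finset.range n) =>
      Finset.sum_le_sum fun j (_ : j ∈ Finset.range n) => key i j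
    have hav : ((n : ℂ) * n) • average U V n x =
        ∑ i ∈ Finset.range n, ∑ j ∈ Finset.range n, conjAut (U ^ i * V ^ j) x := by
      rw [average, smul_smul, mul_mul_mul_comm, mul_inv_cancel₀ hnc, one_mul, one_smul]
    rw [hav]
    simp only [map_sum]
    convert h using 1
    · simp [← Nat.cast_smul_eq_nsmul ℝ, smul_smul]
    · simp only [Finset.sum_add_distrib, Finset.sum_const, Finset.card_range, smul_smul,
        Nat.cast_smul_eq_nsmul]
      congr 1
      rw [Finset.sum_comm]
      exact Finset.sum_congr rfl fun i _ => Finset.sum_comm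
  have h0 : 0 ≤ ((n * n : ℕ) : ℝ) • x := smul_nonneg (Nat.cast_nonneg _) hx
  have hnorm := CStarAlgebra.norm_le_norm_of_nonneg_of_le h0 hsum
  have h1 : ‖((n * n : ℕ) : ℝ) • algebraMap ℝ A ε +
      ∑ s ∈ t, conjAut s⁻¹ (((n : ℂ) * n) • average U V n x)‖ ≤
      ((n : ℝ) * n) * ε + t.card * ((n : ℝ) * n * ‖average U V n x‖) := by
    refine (norm_add_le _ _).trans (add_le_add ?_ ?_)
    · rw [norm_smul, Real.norm_natCast, Nat.cast_mul]
      refine mul_le_mul_of_nonneg_left ?_ (by positivity)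
      rw [norm_algebraMap, CStarRing.norm_one, mul_one, Real.norm_of_nonneg hε]
    · refine (norm_sum_le_of_le _ fun s _ => (norm_conjAut s⁻¹ _).le).trans ?_
      simp [norm_smul]
  have h2 := hnorm.trans h1
  rw [norm_smul, Real.norm_natCast, Nat.cast_mul] at h2
  have h3 : (0 : ℝ) < (n : ℝ) * n := by positivity
  refine le_of_mul_le_mul_left (h2.trans_eq ?_) h3
  ring

end Faithful

/-! ### Words, orbits and averages in the rotation algebra -/

namespace RotationAlgebra

variable {Φ : ℝ}

/-- The generators as unitaries. -/
def unitaryGen (Φ : ℝ) (i : Fin 2) : unitary (RotationAlgebra Φ) := ⟨gen Φ i, gen_mem_unitary i⟩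

/-- The unitary given by a word in the generators. -/
def word (Φ : ℝ) : FreeGroup (Fin 2) →* unitary (RotationAlgebra Φ) :=
  FreeGroup.lift ![unitaryGen Φ 0, unitaryGen Φ 1]

/-- The lift of the generators to the algebra itself is the identity by `hom_ext`, so the canonical
map evaluates monomials as words. -/
theorem coe_mono (w : FreeGroup (Fin 2)) (c : ℂ) :
    (FreeUnitaryAlgebra.mono Φ w c : RotationAlgebra Φ) = c • (word Φ w : RotationAlgebra Φ) := by
  have h : (unitaryGen Φ 0 * unitaryGen Φ 1 : RotationAlgebra Φ) =
      Complex.exp (-(Φ * Complex.I)) • (unitaryGen Φ 1 * unitaryGen Φ 0 : RotationAlgebra Φ) :=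
    u_mul_v
  have hid : lift (unitaryGen Φ 0) (unitaryGen Φ 1) h = StarAlgHom.id ℂ _ :=
    hom_ext (lift_u _ _ h) (lift_v _ _ h)
  have h1 := lift_coe (unitaryGen Φ 0) (unitaryGen Φ 1) h (FreeUnitaryAlgebra.mono Φ w c)
  rw [hid, preLift_mono] at h1
  exact h1

theorem coe_induction {P : RotationAlgebra Φ → Prop} (h0 : P 0)
    (hadd : ∀ x y, P x → P y → P (x + y))
    (hword : ∀ w (c : ℂ), P (c • (word Φ w : RotationAlgebra Φ))) (a : FreeUnitaryAlgebra Φ) :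
    P a := by
  induction a using FreeUnitaryAlgebra.mono_induction with
  | h0 => rwa [Completion.coe_zero]
  | hadd a b ha hb => rw [Completion.coe_add]; exact hadd _ _ ha hb
  | hmono w c => rw [coe_mono]; exact hword w c

theorem exists_coe_near (x : RotationAlgebra Φ) {ε : ℝ} (hε : 0 < ε) :
    ∃ a : FreeUnitaryAlgebra Φ, ‖x - (a : RotationAlgebra Φ)‖ < ε := by
  obtain ⟨a, ha⟩ := Completion.denseRange_coe.exists_dist_lt x hε
  exact ⟨a, by rwa [← dist_eq_norm]⟩

/-- The central unitary `exp (-i Φ)`. -/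
def centralUnitary (Φ : ℝ) : unitary (RotationAlgebra Φ) :=
  scalarUnitary (RotationAlgebra Φ) (Circle.exp (-Φ))

theorem unitaryGen_mul :
    unitaryGen Φ 0 * unitaryGen Φ 1 = centralUnitary Φ * (unitaryGen Φ 1 * unitaryGen Φ 0) := by
  ext
  rw [centralUnitary, scalarUnitary_mul, Circle.coe_exp]
  refine u_mul_v.trans ?_
  simp
  rfl

theorem exists_word_eq (w : FreeGroup (Fin 2)) : ∃ a k l : ℤ,
    word Φ w = centralUnitary Φ ^ a * unitaryGen Φ 0 ^ k * unitaryGen Φ 1 ^ l :=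
  exists_normalForm (commute_scalarUnitary _) unitaryGen_mul w

theorem conjAut_word {a k l : ℤ} {w : FreeGroup (Fin 2)}
    (hw : word Φ w = centralUnitary Φ ^ a * unitaryGen Φ 0 ^ k * unitaryGen Φ 1 ^ l) (i j : ℕ) :
    conjAut (unitaryGen Φ 0 ^ i * unitaryGen Φ 1 ^ j) (word Φ w : RotationAlgebra Φ) =
      (((Circle.exp (-Φ) ^ l : Circle) : ℂ) ^ i * ((Circle.exp (-Φ) ^ (-k) : Circle) : ℂ) ^ j) •
        (word Φ w : RotationAlgebra Φ) := by
  have h := normalForm_conj (commute_scalarUnitary (Circle.exp (-Φ))) (unitaryGen_mul (Φ := Φ))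
    a k l 0 i j
  rw [← centralUnitary, ← hw, zpow_zero, one_mul, zpow_natCast, zpow_natCast] at h
  -- The eigenvalue is split into an i-th and a j-th power, the shape required by
  -- `average_eq_of_conj`.
  have hs : centralUnitary Φ ^ (i * l - j * k : ℤ) = scalarUnitary (RotationAlgebra Φ)
      ((Circle.exp (-Φ) ^ l) ^ i * (Circle.exp (-Φ) ^ (-k)) ^ j) := by
    rw [centralUnitary, ← map_zpow, ← zpow_natCast (Circle.exp (-Φ) ^ l),
      ← zpow_natCast (Circle.exp (-Φ) ^ (-k)), ← zpow_mul, ← zpow_mul, ← zpow_add]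
    congr 2
    ring
  rw [hs] at h
  have h2 := congrArg (Subtype.val) h
  rw [scalarUnitary_mul] at h2
  rw [Unitary.conjStarAlgAut_apply]
  push_cast at h2 ⊢
  exact h2

/-- For l ≠ 0 the relation -l Φ = 2π m would give Φ / (2π) = -m / l. This is where irrationality
enters. -/
theorem circle_exp_zpow_eq_one (hΦ : Irrational (Φ / (2 * Real.pi))) {l : ℤ}
    (h : Circle.exp (-Φ) ^ l = 1) : l = 0 := by
  by_contra hl
  rw [← Circle.exp_zsmul, Circle.exp_eq_one] at h
  obtain ⟨m, hm⟩ := h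
  refine hΦ ⟨-(m / l : ℚ), ?_⟩
  have hl' : (l : ℝ) ≠ 0 := by exact_mod_cast hl
  rw [zsmul_eq_mul] at hm
  push_cast
  field_simp
  linarith

/-- The averages of the conjugates by the generators. -/
abbrev genAverage (Φ : ℝ) : ℕ → RotationAlgebra Φ → RotationAlgebra Φ :=
  average (unitaryGen Φ 0) (unitaryGen Φ 1)

/-- A word with exponents k = l = 0 is a scalar and is fixed by conjugation. Otherwise one of the
two eigenvalues is not 1, and one vanishing factor suffices. -/
theorem exists_tendsto_genAverage_word (hΦ : Irrational (Φ / (2 * Real.pi)))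
    (w : FreeGroup (Fin 2)) :
    ∃ c : ℂ, Tendsto (fun n => genAverage Φ n (word Φ w : RotationAlgebra Φ)) atTop
      (𝓝 (c • 1)) := by
  obtain ⟨a, k, l, hw⟩ := exists_word_eq (Φ := Φ) w
  have hav := average_eq_of_conj _ _ (conjAut_word hw)
  have hlim := ((tendsto_average_pow_circle (Circle.exp (-Φ) ^ l)).mul
    (tendsto_average_pow_circle (Circle.exp (-Φ) ^ (-k)))).smul_const
    (word Φ w : RotationAlgebra Φ)
  by_cases h : l = 0 ∧ k = 0
  · obtain ⟨rfl, rfl⟩ := h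
    refine ⟨(Circle.exp (-Φ) ^ a : Circle), ?_⟩
    have hw' : (word Φ w : RotationAlgebra Φ) = ((Circle.exp (-Φ) ^ a : Circle) : ℂ) • 1 := by
      rw [hw, zpow_zero, zpow_zero, mul_one, centralUnitary, ← map_zpow, scalarUnitary_mul]
      rfl
    rw [← hw']
    refine (hlim.congr fun n => (hav n).symm).trans_eq ?_
    simp
  · refine ⟨0, (hlim.congr fun n => (hav n).symm).trans_eq ?_⟩
    rw [not_and_or] at h
    rcases h with h | h
    · rw [if_neg fun h1 => h (circle_exp_zpow_eq_one hΦ h1)]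
      simp
    · rw [if_neg fun h1 => h (neg_eq_zero.1 (circle_exp_zpow_eq_one hΦ h1)), mul_zero]
      simp

theorem exists_tendsto_genAverage_coe (hΦ : Irrational (Φ / (2 * Real.pi)))
    (a : FreeUnitaryAlgebra Φ) :
    ∃ c : ℂ, Tendsto (fun n => genAverage Φ n (a : RotationAlgebra Φ)) atTop (𝓝 (c • 1)) := by
  refine coe_induction (P := fun x => ∃ c : ℂ,
    Tendsto (fun n => genAverage Φ n x) atTop (𝓝 (c • 1))) ⟨0, ?_⟩ ?_ ?_ a
  · simp [average]
  · rintro x y ⟨c, hc⟩ ⟨d, hd⟩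
    exact ⟨c + d, by simpa only [average_add, add_smul] using hc.add hd⟩
  · intro w z
    obtain ⟨c, hc⟩ := exists_tendsto_genAverage_word hΦ w
    exact ⟨z * c, by simpa only [average_smul, mul_smul] using hc.const_smul z⟩

/-- The orbit of a word lies in its multiples by the unit circle, and sums of compact sets are
compact. -/
theorem exists_isCompact_orbit_coe (a : FreeUnitaryAlgebra Φ) :
    ∃ K : Set (RotationAlgebra Φ), IsCompact K ∧ ∀ i j : ℕ,
      conjAut (unitaryGen Φ 0 ^ i * unitaryGen Φ 1 ^ j) (a : RotationAlgebra Φ) ∈ K := by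
  refine coe_induction (P := fun x => ∃ K : Set (RotationAlgebra Φ), IsCompact K ∧ ∀ i j : ℕ,
    conjAut (unitaryGen Φ 0 ^ i * unitaryGen Φ 1 ^ j) x ∈ K) ⟨{0}, ?_⟩ ?_ ?_ a
  · exact ⟨isCompact_singleton, fun i j => by simp⟩
  · rintro x y ⟨K, hK, hx⟩ ⟨L, hL, hy⟩
    exact ⟨K + L, hK.add hL, fun i j => by
      rw [map_add]; exact Set.add_mem_add (hx i j) (hy i j)⟩
  · intro w c
    obtain ⟨a, k, l, hw⟩ := exists_word_eq (Φ := Φ) w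
    refine ⟨Set.range fun z : Circle => (z : ℂ) • c • (word Φ w : RotationAlgebra Φ),
      isCompact_range (by fun_prop), fun i j => ?_⟩
    rw [map_smul, conjAut_word hw, smul_comm c]
    exact ⟨(Circle.exp (-Φ) ^ l) ^ i * (Circle.exp (-Φ) ^ (-k)) ^ j, by simp⟩

theorem exists_finite_net (x : RotationAlgebra Φ) {ε : ℝ} (hε : 0 < ε) :
    ∃ t : Finset (unitary (RotationAlgebra Φ)), ∀ i j : ℕ, ∃ s ∈ t,
      ‖conjAut (unitaryGen Φ 0 ^ i * unitaryGen Φ 1 ^ j) x - conjAut s x‖ < ε := by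
  classical
  obtain ⟨a, ha⟩ := exists_coe_near x (by positivity : 0 < ε / 3)
  obtain ⟨K, hK, haK⟩ := exists_isCompact_orbit_coe a
  let f : ℕ × ℕ → unitary (RotationAlgebra Φ) :=
    fun p => unitaryGen Φ 0 ^ p.1 * unitaryGen Φ 1 ^ p.2
  have hsub : (Set.range fun p => conjAut (f p) (a : RotationAlgebra Φ)) ⊆ K := by
    rintro _ ⟨p, rfl⟩
    exact haK _ _
  obtain ⟨T, hT, hTfin, hcov⟩ := Metric.finite_approx_of_totallyBounded
    (hK.totallyBounded.subset hsub) (ε / 3) (by positivity)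
  -- The centres lie in the orbit of a, so each is a conjugate of a by some `f p`; these unitaries
  -- form the net, which serves x as well because conjugation is isometric.
  choose g hg using fun y (hy : y ∈ T) => hT hy
  refine ⟨hTfin.toFinset.attach.image fun y => f (g y.1 (hTfin.mem_toFinset.1 y.2)),
    fun i j => ?_⟩
  obtain ⟨y, hy, hlt⟩ := Set.mem_iUnion₂.1 (hcov ⟨(i, j), rfl⟩)
  refine ⟨f (g y hy), Finset.mem_image.2 ⟨⟨y, hTfin.mem_toFinset.2 hy⟩, Finset.mem_attach _ _, rfl⟩,
    ?_⟩
  rw [Metric.mem_ball, dist_eq_norm, ← hg y hy] at hlt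
  have hxa : ∀ s, ‖conjAut s x - conjAut s (a : RotationAlgebra Φ)‖ < ε / 3 := fun s => by
    rwa [← map_sub, norm_conjAut]
  have h1 := hxa (f (i, j))
  have h2 := hxa (f (g y hy))
  rw [norm_sub_rev] at h2
  change ‖conjAut (f (i, j)) x - _‖ < ε
  calc ‖conjAut (f (i, j)) x - conjAut (f (g y hy)) x‖
      = ‖(conjAut (f (i, j)) x - conjAut (f (i, j)) (a : RotationAlgebra Φ)) +
          (conjAut (f (i, j)) (a : RotationAlgebra Φ) -
            conjAut (f (g y hy)) (a : RotationAlgebra Φ)) +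
          (conjAut (f (g y hy)) (a : RotationAlgebra Φ) - conjAut (f (g y hy)) x)‖ := by
        congr 1; abel
    _ ≤ _ := norm_add₃_le
    _ < ε / 3 + ε / 3 + ε / 3 := by gcongr
    _ = ε := by ring

theorem exists_genAverage_near_scalar (hΦ : Irrational (Φ / (2 * Real.pi)))
    (x : RotationAlgebra Φ) {ε : ℝ} (hε : 0 < ε) :
    ∃ n ≠ 0, ∃ c : ℂ, ‖genAverage Φ n x - c • 1‖ < ε := by
  obtain ⟨a, ha⟩ := exists_coe_near x (half_pos hε)
  obtain ⟨c, hc⟩ := exists_tendsto_genAverage_coe hΦ a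
  obtain ⟨n, hn0, hn⟩ :=
    ((eventually_ne_atTop 0).and (Metric.tendsto_nhds.1 hc _ (half_pos hε))).exists
  rw [dist_eq_norm] at hn
  refine ⟨n, hn0, c, ?_⟩
  calc ‖genAverage Φ n x - c • 1‖
      = ‖genAverage Φ n (x - a) + (genAverage Φ n a - c • 1)‖ := by
        rw [genAverage, average_sub]; congr 1; abel
    _ ≤ ‖genAverage Φ n (x - a)‖ + ‖genAverage Φ n a - c • 1‖ := norm_add_le _ _
    _ < ε / 2 + ε / 2 := add_lt_add ((norm_average_le _ _ _ _).trans_lt ha) hn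
    _ = ε := add_halves ε

/-- The zero seminorm is admissible, so a concrete representation is needed to see that the
completion does not collapse. -/
instance : Nontrivial (RotationAlgebra Φ) := by
  refine ⟨1, 0, fun h => ?_⟩
  have h1 := congrArg (fun a => rep1 Φ 0 a (lp.single 2 0 1) 0) h
  simp at h1

end RotationAlgebra

/-! ### Simplicity of the rotation algebra -/

/-- Were z closer to c than ‖c‖, then c⁻¹ • z would be at distance less than 1 from 1, hence an
invertible element of I. -/
theorem norm_le_norm_sub_smul_one {A : Type*} [NormedRing A] [NormedAlgebra ℂ A] [CompleteSpace A]
    {I : TwoSidedIdeal A} (hI : (1 : A) ∉ I) {z : A} (hz : z ∈ I) (c : ℂ) :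
    ‖c‖ ≤ ‖z - c • 1‖ := by
  by_contra! hlt
  have hc : c ≠ 0 := norm_pos_iff.1 ((norm_nonneg _).trans_lt hlt)
  have h1 : ‖1 - c⁻¹ • z‖ < 1 := by
    have h2 : 1 - c⁻¹ • z = c⁻¹ • (c • 1 - z) := by
      rw [smul_sub, smul_smul, inv_mul_cancel₀ hc, one_smul]
    rw [h2, norm_smul, norm_inv, norm_sub_rev, inv_mul_lt_one₀ (norm_pos_iff.2 hc)]
    exact hlt
  have h3 : ((Units.oneSub _ h1 : Aˣ) : A) = c⁻¹ • z := by simp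
  have h4 : c⁻¹ • z ∈ I := by
    rw [Algebra.smul_def]
    exact I.mul_mem_left _ _ hz
  rw [← h3] at h4
  have h5 := I.mul_mem_left (↑(Units.oneSub _ h1)⁻¹ : A) _ h4
  rw [Units.inv_mul] at h5
  exact hI h5

/-- For `Φ / (2π)` irrational, the rotation algebra is simple. -/
theorem isSimpleCStarAlgebra_rotationAlgebra {Φ : ℝ} (hΦ : Irrational (Φ / (2 * Real.pi))) :
    IsSimpleCStarAlgebra (RotationAlgebra Φ) := by
  let := CStarAlgebra.spectralOrder (RotationAlgebra Φ)
  have := CStarAlgebra.spectralOrderedRing (RotationAlgebra Φ)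
  refine ⟨inferInstance, fun I _ => ?_⟩
  by_cases hI : (1 : RotationAlgebra Φ) ∈ I
  · exact Or.inr ((TwoSidedIdeal.one_mem_iff I).1 hI)
  refine Or.inl (eq_bot_iff.2 fun a ha => ?_)
  rw [TwoSidedIdeal.mem_bot, ← CStarRing.star_mul_self_eq_zero_iff, ← norm_le_zero_iff]
  have hx : star a * a ∈ I := I.mul_mem_left _ _ ha
  refine le_of_forall_pos_le_add fun ε hε => ?_
  obtain ⟨t, ht⟩ := RotationAlgebra.exists_finite_net (star a * a) (half_pos hε)
  -- With this tolerance δ, `hcn` gives ‖c‖ ≤ δ, so the average has norm at most 2δ, and `t.card`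
  -- times that is at most ε / 2. The + 1 keeps the denominator positive.
  obtain ⟨n, hn, c, hc⟩ := RotationAlgebra.exists_genAverage_near_scalar hΦ (star a * a)
    (by positivity : 0 < ε / (4 * (t.card + 1)))
  have hcn := norm_le_norm_sub_smul_one hI
    (average_mem (RotationAlgebra.unitaryGen Φ 0) (RotationAlgebra.unitaryGen Φ 1) I n hx) c
  have hav : ‖RotationAlgebra.genAverage Φ n (star a * a)‖ ≤ ε / (2 * (t.card + 1)) := by
    calc ‖RotationAlgebra.genAverage Φ n (star a * a)‖
        = ‖(RotationAlgebra.genAverage Φ n (star a * a) - c • 1) + c • 1‖ := by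
          rw [sub_add_cancel]
      _ ≤ ‖RotationAlgebra.genAverage Φ n (star a * a) - c • 1‖ +
          ‖c • (1 : RotationAlgebra Φ)‖ := norm_add_le _ _
      _ ≤ ε / (4 * (t.card + 1)) + ε / (4 * (t.card + 1)) := by
          rw [norm_smul, CStarRing.norm_one, mul_one]
          exact add_le_add hc.le (hcn.trans hc.le)
      _ = ε / (2 * (t.card + 1)) := by field_simp; norm_num
  have hbound := norm_le_of_finite_net _ _ (star_mul_self_nonneg a) t ht hn
  have hcard : (t.card : ℝ) * (ε / (2 * (t.card + 1))) ≤ ε / 2 := by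
    rw [mul_div_assoc', div_le_div_iff₀ (by positivity) (by positivity)]
    nlinarith
  have := mul_le_mul_of_nonneg_left hav (Nat.cast_nonneg t.card)
  linarith

/-! ### Spectral permanence for representations of the matrix algebra -/

/-- An injective `*`-homomorphism is isometric, so its range is a closed `*`-subalgebra, and spectra
do not change on passing to such a subalgebra. -/
theorem spectrum_map_of_injective {A B F : Type*} [CStarAlgebra A] [CStarAlgebra B]
    [FunLike F A B] [AlgHomClass F ℂ A B] [StarHomClass F A B]
    (f : F) (hf : Function.Injective f) (a : A) : spectrum ℂ (f a) = spectrum ℂ a := by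
  let g : A →⋆ₐ[ℂ] B := (f : A →⋆ₐ[ℂ] B)
  have hg : Function.Injective g := hf
  have hiso : Isometry g := NonUnitalStarAlgHom.isometry g hg
  have hclosed : IsClosed (g.range : Set B) := by
    exact hiso.isClosedEmbedding.isClosed_range
  have h1 := StarSubalgebra.spectrum_eq (hS := hclosed) (a := g.rangeRestrict a)
  have h2 := AlgEquiv.spectrum_eq (StarAlgEquiv.ofInjective g hg) a
  exact h1.symm.trans h2

/-- The kernel is a closed ideal, and it is proper because 1 maps to 1 ≠ 0. -/
theorem injective_of_isSimple {A B : Type*} [CStarAlgebra A] [CStarAlgebra B] [Nontrivial B]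
    (hA : IsSimpleCStarAlgebra A) (f : A →⋆ₐ[ℂ] B) : Function.Injective f := by
  have hf : Continuous f := AddMonoidHomClass.continuous_of_bound f 1
    fun a => by simpa using NonUnitalStarAlgHom.norm_apply_le f a
  have hcl : IsClosed (TwoSidedIdeal.ker f : Set A) := by
    have : (TwoSidedIdeal.ker f : Set A) = f ⁻¹' {0} := by
      ext a
      simp [TwoSidedIdeal.mem_ker]
    rw [this]
    exact isClosed_singleton.preimage hf
  rcases hA.2 _ hcl with h | h
  · exact (TwoSidedIdeal.ker_eq_bot f).1 h
  · have h1 := (TwoSidedIdeal.mem_ker f).1 ((TwoSidedIdeal.one_mem_iff _).2 h)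
    simp at h1

instance {X : Type} [Nonempty X] : Nontrivial (L2 X →L[ℂ] L2 X) := by
  classical
  obtain ⟨x⟩ := ‹Nonempty X›
  refine ⟨1, 0, fun h => ?_⟩
  have h1 := congrArg (fun T => T (lp.single 2 x 1) x) h
  simp at h1

theorem blockOp_injective {X : Type} :
    Function.Injective (blockOp : Matrix (Fin 2) (Fin 2) (L2 X →L[ℂ] L2 X) →⋆ₐ[ℂ] _) := by
  rw [injective_iff_map_eq_zero]
  intro M hM
  ext i j ψ : 3
  have h := congrArg (fun T => T (PiLp.single 2 j ψ) i) hM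
  have h' : M i j ψ = 0 := by simpa [blockOp_apply, Pi.single_apply, apply_ite] using h
  rw [h']
  rfl

theorem spectrum_liftRep {Φ : ℝ} {X : Type} (π : RotationAlgebra Φ →⋆ₐ[ℂ] (L2 X →L[ℂ] L2 X))
    (hπ : Function.Injective π) (a : Matrix (Fin 2) (Fin 2) (RotationAlgebra Φ)) :
    spectrum ℂ (liftRep π a) = spectrum ℂ a := by
  let := CStarAlgebra.spectralOrder (RotationAlgebra Φ)
  have := CStarAlgebra.spectralOrderedRing (RotationAlgebra Φ)
  have hinj : Function.Injective (liftRep π) :=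
    blockOp_injective.comp (Matrix.map_injective hπ)
  -- The spectrum is purely algebraic, so it may be computed in `CStarMatrix`, the same `*`-algebra
  -- with its C*-norm.
  have h : spectrum ℂ (liftRep π a) = spectrum ℂ (CStarMatrix.ofMatrix a) :=
    spectrum_map_of_injective (A := CStarMatrix (Fin 2) (Fin 2) (RotationAlgebra Φ))
      ((liftRep π).comp (CStarMatrix.ofMatrixStarAlgEquiv.symm :
        CStarMatrix (Fin 2) (Fin 2) (RotationAlgebra Φ) ≃⋆ₐ[ℂ] _).toStarAlgHom) hinj
      (CStarMatrix.ofMatrix a)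
  exact h

/-! ### The walks as representations of the abstract walk -/

theorem coinOp_const (C : Matrix.unitaryGroup (Fin 2) ℂ) {X : Type} :
    coinOp (fun _ : X => C) =
      blockOp ((C : Matrix (Fin 2) (Fin 2) ℂ).map (algebraMap ℂ (L2 X →L[ℂ] L2 X))) := by
  refine blockFun_ext fun ψ i => ?_
  ext x
  simp [coinOp_apply, blockOp_apply, Algebra.algebraMap_eq_smul_one]
  rfl

theorem liftRep_apply {Φ : ℝ} {X : Type} (π : RotationAlgebra Φ →⋆ₐ[ℂ] (L2 X →L[ℂ] L2 X))
    (a : Matrix (Fin 2) (Fin 2) (RotationAlgebra Φ)) : liftRep π a = blockOp (a.map π) := rfl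

theorem liftRep_abstractWalk {Φ : ℝ} {X : Type} (π : RotationAlgebra Φ →⋆ₐ[ℂ] (L2 X →L[ℂ] L2 X))
    (S T : unitary (L2 X →L[ℂ] L2 X)) (hS : π (RotationAlgebra.u Φ) = S)
    (hT : π (RotationAlgebra.v Φ) = T) :
    liftRep π (abstractWalk Φ) =
      stateShift S * coinOp (fun _ => hadamard) * stateShift T * coinOp (fun _ => hadamard) := by
  have hdiag : ∀ (a : RotationAlgebra Φ) (R : unitary (L2 X →L[ℂ] L2 X)), π a = R →
      liftRep π !![a, 0; 0, star a] = stateShift R := by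
    intro a R h
    rw [liftRep_apply, stateShift]
    congr 1
    ext i j : 1
    fin_cases i <;> fin_cases j <;> simp [h, map_star]
  have hhad : liftRep π
      ((hadamard : Matrix (Fin 2) (Fin 2) ℂ).map (algebraMap ℂ (RotationAlgebra Φ))) =
      coinOp fun _ => hadamard := by
    rw [coinOp_const, liftRep_apply, Matrix.map_map]
    congr 2
    ext1 z
    exact AlgHomClass.commutes π z
  rw [abstractWalk, map_mul, map_mul, map_mul, hdiag _ _ hS, hdiag _ _ hT, hhad]

theorem magneticWalk_eq (Φ : ℝ) : magneticWalk Φ = liftRep (rep2 Φ) (abstractWalk Φ) :=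
  (liftRep_abstractWalk _ _ _ (RotationAlgebra.lift_u _ _ _) (RotationAlgebra.lift_v _ _ _)).symm

/-- The matrix `diag(1, -i)`. -/
def phaseCoin : Matrix.unitaryGroup (Fin 2) ℂ :=
  ⟨!![1, 0; 0, -Complex.I], by
    rw [Matrix.mem_unitaryGroup_iff]
    ext i j
    fin_cases i <;> fin_cases j <;> simp [Matrix.mul_apply, Matrix.star_apply]⟩

theorem map_algebraMap_mem_unitary {B : Type*} [Ring B] [StarRing B] [Algebra ℂ B]
    [StarModule ℂ B] (C : Matrix.unitaryGroup (Fin 2) ℂ) :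
    (C : Matrix (Fin 2) (Fin 2) ℂ).map (algebraMap ℂ B) ∈ unitary (Matrix (Fin 2) (Fin 2) B) := by
  have hstar : star ((C : Matrix (Fin 2) (Fin 2) ℂ).map (algebraMap ℂ B)) =
      (star (C : Matrix (Fin 2) (Fin 2) ℂ)).map (algebraMap ℂ B) := by
    ext1 i j
    exact (algebraMap_star_comm _).symm
  rw [Unitary.mem_iff, hstar, ← Matrix.map_mul, ← Matrix.map_mul, (Unitary.mem_iff.1 C.2).1,
    (Unitary.mem_iff.1 C.2).2]
  simp

theorem coinOp_const_mem_unitary (C : Matrix.unitaryGroup (Fin 2) ℂ) {X : Type} :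
    coinOp (fun _ : X => C) ∈ unitary (SpinL2 X →L[ℂ] SpinL2 X) := by
  rw [coinOp_const]
  exact Unitary.map_mem blockOp (map_algebraMap_mem_unitary C)

theorem star_weightedShift_apply {X : Type} (e : X ≃ X) (U : X → Circle) (ψ : L2 X) (x : X) :
    star (weightedShift e U : L2 X →L[ℂ] L2 X) ψ x = (U x : ℂ)⁻¹ * ψ (e x) := by
  have h : star (weightedShift e U : L2 X →L[ℂ] L2 X) *
      (weightedShift e U : L2 X →L[ℂ] L2 X) = 1 := Unitary.coe_star_mul_self _
  -- The adjoint of a unitary is its inverse, so star W * W = 1 is evaluated at the preimage of ψ.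
  have h2 := congrArg (fun T => T ((weightedShiftEquiv e U).symm ψ) x) h
  have h3 : (weightedShift e U : L2 X →L[ℂ] L2 X) ((weightedShiftEquiv e U).symm ψ) = ψ :=
    (weightedShiftEquiv e U).apply_symm_apply ψ
  simp only [mul_apply_eq_comp, h3] at h2
  exact h2

theorem stateShift_phase (Φ θ : ℝ) (ψ : SpinL2 ℤ) (x : ℤ) :
    stateShift (phase Φ θ) ψ 0 x = Complex.exp ((x * Φ + θ) * Complex.I) * ψ 0 x ∧
    stateShift (phase Φ θ) ψ 1 x = Complex.exp (-(x * Φ + θ) * Complex.I) * ψ 1 x := by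
  constructor
  · simp [stateShift, blockOp_apply, phase, weightedShift_apply, Circle.coe_exp, -Circle.exp_add]
  · simp [stateShift, blockOp_apply, star_weightedShift_apply, phase, Circle.coe_exp,
      ← Complex.exp_neg, -Circle.exp_add]
    left
    congr 1
    ring

theorem stateShift_translation (ψ : SpinL2 ℤ) (x : ℤ) :
    stateShift translation ψ 0 x = ψ 0 (x - 1) ∧
    stateShift translation ψ 1 x = ψ 1 (x + 1) := by
  constructor
  · simp [stateShift, blockOp_apply, translation, weightedShift_apply, sub_eq_add_neg]
  · simp [stateShift, blockOp_apply, star_weightedShift_apply, translation]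

/-- With α = xΦ + θ, the matrix C_H diag(e^{iα}, e^{-iα}) C_H has diagonal entries cos α and
off-diagonal entries i sin α. Conjugation by diag(1, -i) makes it the rotation by α, and this
diagonal coin commutes with the state-dependent shift. -/
theorem almostMathieuWalk_mul_phaseCoin (Φ θ : ℝ) :
    almostMathieuWalk Φ θ * coinOp (fun _ => phaseCoin) =
      coinOp (fun _ => phaseCoin) * liftRep (rep1 Φ θ) (abstractWalk Φ) := by
  rw [liftRep_abstractWalk (rep1 Φ θ) translation (phase Φ θ) (RotationAlgebra.lift_u _ _ _)
    (RotationAlgebra.lift_v _ _ _), almostMathieuWalk]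
  refine blockFun_ext fun ψ i => ?_
  ext x
  have hr : ((√2 : ℝ) : ℂ)⁻¹ * ((√2 : ℝ) : ℂ)⁻¹ = 1 / 2 := by
    rw [← mul_inv, ← Complex.ofReal_mul, Real.mul_self_sqrt (by norm_num)]
    norm_num
  fin_cases i
  · simp only [mul_apply_eq_comp, coinOp_apply, Fin.sum_univ_two, Fin.zero_eta,
      stateShift_translation, stateShift_phase, phaseCoin, hadamard, rotation]
    simp
    have h1 : (Φ : ℂ) * (x - 1) + θ = (x - 1) * Φ + θ := by ring
    have h2 : (-θ + -((x - 1) * Φ)) * Complex.I = (-((x - 1) * Φ + θ : ℂ)) * Complex.I := by ring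
    rw [h1, h2, Complex.exp_mul_I, Complex.exp_mul_I, Complex.cos_neg, Complex.sin_neg]
    -- The shift reads the coin at x - 1 here and at x + 1 in the other component. What remains is
    -- trigonometric, with `hr` merging the two Hadamard factors 1/√2.
    generalize ((x : ℂ) - 1) * Φ + θ = α
    linear_combination
      (-2) * (Complex.cos α * ψ 0 (x - 1) + Complex.sin α * Complex.I * ψ 1 (x - 1)) * hr
  · simp only [mul_apply_eq_comp, coinOp_apply, Fin.sum_univ_two, Fin.mk_one,
      stateShift_translation, stateShift_phase, phaseCoin, hadamard, rotation]
    simp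
    have h1 : (Φ : ℂ) * (x + 1) + θ = (x + 1) * Φ + θ := by ring
    have h2 : (-θ + -((x + 1) * Φ)) * Complex.I = (-((x + 1) * Φ + θ : ℂ)) * Complex.I := by ring
    rw [h1, h2, Complex.exp_mul_I, Complex.exp_mul_I, Complex.cos_neg, Complex.sin_neg]
    generalize ((x : ℂ) + 1) * Φ + θ = α
    linear_combination
      (-2) * (Complex.sin α * ψ 0 (x + 1) - Complex.cos α * Complex.I * ψ 1 (x + 1)) * hr +
      2 * ((√2 : ℝ) : ℂ)⁻¹ * ((√2 : ℝ) : ℂ)⁻¹ * Complex.sin α * ψ 0 (x + 1) * Complex.I_sq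

end MagneticWalk

end

/-! ### Comparison of the spectra -/

theorem mainTheorem6 (Φ θ : ℝ) (hΦ : Irrational (Φ / (2 * Real.pi))) :
    MagneticWalk.IsSimpleCStarAlgebra (MagneticWalk.RotationAlgebra Φ) ∧
    MagneticWalk.magneticWalk Φ =
      MagneticWalk.liftRep (MagneticWalk.rep2 Φ) (MagneticWalk.abstractWalk Φ) ∧
    (∃ D ∈ unitary (MagneticWalk.SpinL2 ℤ →L[ℂ] MagneticWalk.SpinL2 ℤ),
      MagneticWalk.almostMathieuWalk Φ θ =
        D * MagneticWalk.liftRep (MagneticWalk.rep1 Φ θ) (MagneticWalk.abstractWalk Φ) * star D) ∧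
    spectrum ℂ (MagneticWalk.magneticWalk Φ) =
      spectrum ℂ (MagneticWalk.liftRep (MagneticWalk.rep2 Φ) (MagneticWalk.abstractWalk Φ)) ∧
    spectrum ℂ (MagneticWalk.liftRep (MagneticWalk.rep2 Φ) (MagneticWalk.abstractWalk Φ)) =
      spectrum ℂ (MagneticWalk.liftRep (MagneticWalk.rep1 Φ θ) (MagneticWalk.abstractWalk Φ)) ∧
    spectrum ℂ (MagneticWalk.liftRep (MagneticWalk.rep1 Φ θ) (MagneticWalk.abstractWalk Φ)) =
      spectrum ℂ (MagneticWalk.almostMathieuWalk Φ θ) := by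
  have hsimple := MagneticWalk.isSimpleCStarAlgebra_rotationAlgebra hΦ
  let D : unitary (MagneticWalk.SpinL2 ℤ →L[ℂ] MagneticWalk.SpinL2 ℤ) :=
    ⟨_, MagneticWalk.coinOp_const_mem_unitary MagneticWalk.phaseCoin⟩
  have hD : MagneticWalk.almostMathieuWalk Φ θ =
      D * MagneticWalk.liftRep (MagneticWalk.rep1 Φ θ) (MagneticWalk.abstractWalk Φ) *
        star (D : MagneticWalk.SpinL2 ℤ →L[ℂ] MagneticWalk.SpinL2 ℤ) := by
    change _ = MagneticWalk.coinOp (fun _ => MagneticWalk.phaseCoin) * _ * _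
    rw [← MagneticWalk.almostMathieuWalk_mul_phaseCoin, mul_assoc]
    exact (mul_one _).symm.trans (congrArg _ D.2.2.symm)
  refine ⟨hsimple, MagneticWalk.magneticWalk_eq Φ, ⟨D, D.2, hD⟩,
    by rw [MagneticWalk.magneticWalk_eq], ?_, ?_⟩
  -- Both sides equal the spectrum of the abstract walk in the matrix algebra.
  · rw [MagneticWalk.spectrum_liftRep _ (MagneticWalk.injective_of_isSimple hsimple _),
      MagneticWalk.spectrum_liftRep _ (MagneticWalk.injective_of_isSimple hsimple _)]
  · rw [hD]
    exact (Unitary.spectrum_star_right_conjugate (U := D)).symm
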